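/- Let $n\ge 1$ be an integer and $[n]=\{1,\dots,n\}$. The descent set of a permutation $\sigma=\sigma_1\cdots\sigma_n$ of $[n]$ is $D(\sigma)=\{i\in[n-1] : \sigma_i>\sigma_{i+1}\}$; its alternating descent set $\hat D(\sigma)$ consists of the odd $i\in[n-1]$ with $\sigma_i>\sigma_{i+1}$ and the even $i\in[n-1]$ with $\sigma_i<\sigma_{i+1}$. For $S\subseteq[n-1]$ let $\beta_n(S)$ and $\hat\beta_n(S)$ be the numbers of permutations $\sigma$ of $[n]$ with $D(\sigma)=S$ and with $\hat D(\sigma)=S$, respectively, and let $u_S=u_1u_2\cdots u_{n-1}$ be the monomial in non-commuting variables $a,b$ with $u_i=b$ if $i\in S$ and $u_i=a$ if $i\notin S$. Put $$\Psi_n(a,b)=\sum_{S\subseteq[n-1]}\beta_n(S)\,u_S,\qquad \hat\Psi_n(a,b)=\sum_{S\subseteq[n-1]}\hat\beta_n(S)\,u_S .$$ Then there are unique polynomials $\Phi_n(c,d)$ and $\hat\Phi_n(c,d)$ with integer coefficients in two non-commuting variables $c,d$ such that $$\Phi_n(a+b,\,ab+ba)=\Psi_n(a,b),\qquad \hat\Phi_n(a+b,\,ab+ba)=\hat\Psi_n(a,b),$$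 and the sum of the coefficients of $\hat\Phi_n(c,-d)$ equals $\Phi_n(1,2)$ and equals $|\mathcal R_n|$, where $\mathcal R_n$ is the set of permutations $\sigma$ of $[n]$ with no two consecutive descents (there is no $i$ with $i\in D(\sigma)$ and $i+1\in D(\sigma)$) and no descent at the end ($n-1\notin D(\sigma)$). -/

import Mathlib

namespace CdIndex

open Finset

/-! ### Polynomials in two non-commuting variables -/

/-- Integer polynomials in two non-commuting variables. The variables are called `a, b`
or `c, d` according to the role of the polynomial. -/
abbrev NCPoly : Type := FreeAlgebra ℤ (Fin 2)

/-- The first variable (`a` or `c`). -/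
noncomputable def X₁ : NCPoly := FreeAlgebra.ι ℤ 0

/-- The second variable (`b` or `d`). -/
noncomputable def X₂ : NCPoly := FreeAlgebra.ι ℤ 1

/-- The value `P(x, y)` at two elements of a (not necessarily commutative) ring. -/
noncomputable def evalAt {A : Type*} [Ring A] (P : NCPoly) (x y : A) : A :=
  FreeAlgebra.lift ℤ ![x, y] P

/-- The sum of the coefficients of a polynomial, over all words in the two variables. -/
noncomputable def coeffSum (P : NCPoly) : ℤ :=
  (FreeAlgebra.equivMonoidAlgebraFreeMonoid P).coeff.sum fun _ r => r

/-! ### Permutations and their descents -/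

/-- The one-line notation `σ_1 σ_2 ⋯ σ_n` of a permutation of `[n] = {1, …, n}`, represented by
a permutation of `{0, …, n - 1}`: the entry `σ_i` for `1 ≤ i ≤ n` (and `0` for other `i`). -/
def entry {n : ℕ} (σ : Equiv.Perm (Fin n)) (i : ℕ) : ℕ :=
  if h : 1 ≤ i ∧ i ≤ n then (σ ⟨i - 1, by omega⟩ : ℕ) + 1 else 0

/-- The descent set, a subset of `[n-1]`. -/
def descentSet {n : ℕ} (σ : Equiv.Perm (Fin n)) : Finset ℕ :=
  {i ∈ Icc 1 (n - 1) | entry σ i > entry σ (i + 1)}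

/-- The alternating descent set, a subset of `[n-1]`: the odd positions of descents and the even
positions of ascents. -/
def altDescentSet {n : ℕ} (σ : Equiv.Perm (Fin n)) : Finset ℕ :=
  {i ∈ Icc 1 (n - 1) | (Odd i ∧ entry σ i > entry σ (i + 1)) ∨
    (Even i ∧ entry σ i < entry σ (i + 1))}

/-- The number of permutations of `[n]` with descent set `S`. -/
def beta (n : ℕ) (S : Finset ℕ) : ℕ :=
  #{σ : Equiv.Perm (Fin n) | descentSet σ = S}

/-- The number of permutations of `[n]` with alternating descent set `S`. -/
def betaHat (n : ℕ) (S : Finset ℕ) : ℕ :=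
  #{σ : Equiv.Perm (Fin n) | altDescentSet σ = S}

/-! ### The generating functions in `a` and `b` -/

/-- The monomial `u_S = u_1 u_2 ⋯ u_{n-1}`, with `u_i = b` if `i ∈ S` and `u_i = a` otherwise. -/
noncomputable def abMonomial (n : ℕ) (S : Finset ℕ) : NCPoly :=
  ((List.range' 1 (n - 1)).map fun i => if i ∈ S then X₂ else X₁).prod

/-- The generating function `Ψ_n(a, b)` of the descent set: the `ab`-index of the Boolean
algebra `B_n`. -/
noncomputable def Psi (n : ℕ) : NCPoly :=
  ∑ S ∈ (Icc 1 (n - 1)).powerset, beta n S • abMonomial n S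

/-- The generating function of the alternating descent set. -/
noncomputable def PsiHat (n : ℕ) : NCPoly :=
  ∑ S ∈ (Icc 1 (n - 1)).powerset, betaHat n S • abMonomial n S

/-- `P(c, d)` expresses `Q(a, b)` through `c = a + b` and `d = ab + ba`. -/
def IsCdForm (P Q : NCPoly) : Prop :=
  evalAt P (X₁ + X₂) (X₁ * X₂ + X₂ * X₁) = Q

/-! ### Shapiro–Woan–Getu permutations -/

/-- The permutations of `[n]` with no two consecutive descents and no descent at the end. -/
def reducedPerms (n : ℕ) : Finset (Equiv.Perm (Fin n)) :=
  {σ | (∀ i ∈ descentSet σ, i + 1 ∉ descentSet σ) ∧ n - 1 ∉ descentSet σ}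

end CdIndex

/-! Inserting a maximal entry gives `Ψ_{n+1} = bΨ_n + Ψ_n a + D(Ψ_n)`, where the derivation `D`
sends `a` and `b` to `ab`. Adding commutators changes `D` into derivations suited to two purposes.
With `a ↦ ba`, `b ↦ ab` the recursion preserves polynomials in `c, d`, so `Φ_n` exists
(`exists_cdHom_eq_Psi`); uniqueness is `cdHom_injective`. With `a, b ↦ ba` it shows that a
functional `L` with `L(1) = 1`, `L(aP + Pb) = L(P)` and `L(P ba Q) = L(P)L(Q)` is determined on
every `Ψ_n` (`eq_on_Psi`). Two such functionals are the count of words without `bb` and without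
final `b`, giving `|R_n|`, and the evaluation at `a = α`, `b = 1 - α` with `α(1 - α) = 1`, giving
`Φ_n(1, 2)`. Exchanging `a` and `b` at even positions turns `Ψ_n` into `Ψ̂_n`, fixes `c` and
replaces `ab + ba` by `a² + b² = c² - d`. Hence `Φ̂_n(c, d) = Φ_n(c, c² - d)`, and `Φ̂_n(1, -1) =
Φ_n(1, 2)`. -/

namespace CdIndex

open Finset

/-! ### Evaluation of polynomials in two non-commuting variables -/

/-- Evaluation at two elements of a ring, as a ring homomorphism. -/
noncomputable def evalHom {A : Type*} [Ring A] (x y : A) : NCPoly →+* A :=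
  (FreeAlgebra.lift ℤ ![x, y]).toRingHom

theorem evalAt_eq_evalHom {A : Type*} [Ring A] (P : NCPoly) (x y : A) :
    evalAt P x y = evalHom x y P := rfl

@[simp] theorem evalHom_X₁ {A : Type*} [Ring A] (x y : A) : evalHom x y X₁ = x := by
  simp [evalHom, X₁]

@[simp] theorem evalHom_X₂ {A : Type*} [Ring A] (x y : A) : evalHom x y X₂ = y := by
  simp [evalHom, X₂]

@[elab_as_elim]
theorem NCPoly.induction {motive : NCPoly → Prop} (P : NCPoly)
    (intCast : ∀ r : ℤ, motive (r : NCPoly)) (X₁ : motive X₁) (X₂ : motive X₂)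
    (mul : ∀ P Q, motive P → motive Q → motive (P * Q))
    (add : ∀ P Q, motive P → motive Q → motive (P + Q)) : motive P := by
  refine FreeAlgebra.induction ℤ (Fin 2) (fun r => ?_) (fun i => ?_) mul add P
  · rw [eq_intCast]
    exact intCast r
  · fin_cases i
    · exact X₁
    · exact X₂

theorem ringHom_ext {A : Type*} [Ring A] {f g : NCPoly →+* A} (h₁ : f X₁ = g X₁)
    (h₂ : f X₂ = g X₂) : f = g := by
  ext P
  induction P using NCPoly.induction with
  | intCast r => simp
  | X₁ => exact h₁
  | X₂ => exact h₂
  | mul P Q hP hQ => rw [map_mul, map_mul, hP, hQ]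
  | add P Q hP hQ => rw [map_add, map_add, hP, hQ]

theorem map_evalHom {A B : Type*} [Ring A] [Ring B] (f : A →+* B) (x y : A) (P : NCPoly) :
    f (evalHom x y P) = evalHom (f x) (f y) P := by
  have : f.comp (evalHom x y) = evalHom (f x) (f y) := ringHom_ext (by simp) (by simp)
  exact DFunLike.congr_fun this P

theorem coeffSum_eq_evalHom (P : NCPoly) : coeffSum P = evalHom (1 : ℤ) 1 P := by
  have h : ((MonoidAlgebra.lift ℤ ℤ (FreeMonoid (Fin 2)) 1).toRingHom.comp
      (FreeAlgebra.equivMonoidAlgebraFreeMonoid (R := ℤ) (X := Fin 2)).toAlgHom.toRingHom) =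
      evalHom (1 : ℤ) 1 := by
    apply ringHom_ext <;> simp [X₁, X₂, evalHom, FreeAlgebra.equivMonoidAlgebraFreeMonoid]
  rw [← h]
  simp [coeffSum, MonoidAlgebra.lift_apply]

/-! ### The substitution `c = a + b`, `d = ab + ba` -/

/-- The substitution `c ↦ a + b`, `d ↦ ab + ba`. -/
noncomputable abbrev cdHom : NCPoly →+* NCPoly := evalHom (X₁ + X₂) (X₁ * X₂ + X₂ * X₁)

/-- The action of `a` by which a `cd`-polynomial is recovered from its `ab`-expansion. -/
noncomputable def recoverA : AddMonoid.End (NCPoly × NCPoly × NCPoly) where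
  toFun v := (v.2.1, X₁ * v.2.1, 0)
  map_zero' := by simp
  map_add' u v := by simp [mul_add]

/-- The action of `b` by which a `cd`-polynomial is recovered from its `ab`-expansion. -/
noncomputable def recoverB : AddMonoid.End (NCPoly × NCPoly × NCPoly) where
  toFun v := (v.2.2, X₂ * v.1, X₁ * v.2.2 - X₂ * v.1)
  map_zero' := by simp
  map_add' u v := by simp [mul_add]; abel

theorem recoverA_apply (v : NCPoly × NCPoly × NCPoly) :
    recoverA v = (v.2.1, X₁ * v.2.1, 0) := rfl

theorem recoverB_apply (v : NCPoly × NCPoly × NCPoly) :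
    recoverB v = (v.2.2, X₂ * v.1, X₁ * v.2.2 - X₂ * v.1) := rfl

theorem end_mul_apply {M : Type*} [AddCommGroup M] (f g : AddMonoid.End M) (x : M) :
    (f * g) x = f (g x) := rfl

theorem end_add_apply {M : Type*} [AddCommGroup M] (f g : AddMonoid.End M) (x : M) :
    (f + g) x = f x + g x := rfl

/-- On triples with `v₂ + v₃ = c v₁`, a condition kept by both operators `A` and `B`, the first
coordinate of `(A + B)v` is `c v₁`; that of `ABv` is `d v₁` and that of `BAv` is `0`. -/
theorem recover_cdHom (P : NCPoly) : ∀ v : NCPoly × NCPoly × NCPoly, v.2.1 + v.2.2 = X₁ * v.1 →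
    (evalHom recoverA recoverB (cdHom P) v).1 = P * v.1 ∧
    (evalHom recoverA recoverB (cdHom P) v).2.1 + (evalHom recoverA recoverB (cdHom P) v).2.2 =
      X₁ * (evalHom recoverA recoverB (cdHom P) v).1 := by
  induction P using NCPoly.induction with
  | intCast r =>
    intro v hv
    simp only [map_intCast, AddMonoid.End.intCast_apply, Prod.smul_fst, Prod.smul_snd]
    rw [← smul_add, hv, zsmul_eq_mul, zsmul_eq_mul, ← mul_assoc, ← mul_assoc]
    exact ⟨rfl, by rw [Int.cast_comm]⟩
  | X₁ =>
    intro v hv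
    simp [recoverA_apply, recoverB_apply, end_add_apply, hv, ← mul_add]
  | X₂ =>
    intro v hv
    simp [recoverA_apply, recoverB_apply, end_add_apply, end_mul_apply]
  | mul P Q hP hQ =>
    intro v hv
    obtain ⟨h₁, h₂⟩ := hQ v hv
    obtain ⟨h₃, h₄⟩ := hP _ h₂
    simp only [map_mul, end_mul_apply]
    exact ⟨by rw [h₃, h₁, mul_assoc], h₄⟩
  | add P Q hP hQ =>
    intro v hv
    obtain ⟨h₁, h₂⟩ := hQ v hv
    obtain ⟨h₃, h₄⟩ := hP v hv
    simp only [map_add, end_add_apply, Prod.fst_add, Prod.snd_add]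
    refine ⟨by rw [h₃, h₁, add_mul], ?_⟩
    rw [mul_add, ← h₂, ← h₄]
    abel

theorem cdHom_injective : Function.Injective cdHom := by
  intro P Q h
  have hP := (recover_cdHom P (1, X₁, 0) (by simp)).1
  have hQ := (recover_cdHom Q (1, X₁, 0) (by simp)).1
  rw [h] at hP
  simpa using hP.symm.trans hQ

/-! ### Derivations of the free algebra -/

/-- The derivation of the free algebra with given values on the two variables. -/
noncomputable def deriv (x y : NCPoly) : NCPoly →+ NCPoly where
  toFun P := (evalHom (TrivSqZeroExt.inl X₁ + TrivSqZeroExt.inr x)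
    (TrivSqZeroExt.inl X₂ + TrivSqZeroExt.inr y) P : TrivSqZeroExt NCPoly NCPoly).snd
  map_zero' := by simp
  map_add' := by simp

theorem deriv_X₁ (x y : NCPoly) : deriv x y X₁ = x := by simp [deriv]

theorem deriv_X₂ (x y : NCPoly) : deriv x y X₂ = y := by simp [deriv]

theorem deriv_intCast (x y : NCPoly) (r : ℤ) : deriv x y (r : NCPoly) = 0 := by
  simp [deriv]

theorem deriv_one (x y : NCPoly) : deriv x y 1 = 0 := by simp [deriv]

theorem deriv_mul (x y P Q : NCPoly) :
    deriv x y (P * Q) = P * deriv x y Q + deriv x y P * Q := by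
  have h : ∀ P : NCPoly, (evalHom (TrivSqZeroExt.inl X₁ + TrivSqZeroExt.inr x)
      (TrivSqZeroExt.inl X₂ + TrivSqZeroExt.inr y) P : TrivSqZeroExt NCPoly NCPoly).fst = P := by
    intro P
    induction P using NCPoly.induction with
    | intCast r => simp
    | X₁ => simp
    | X₂ => simp
    | mul P Q hP hQ => rw [map_mul, TrivSqZeroExt.fst_mul, hP, hQ]
    | add P Q hP hQ => rw [map_add, TrivSqZeroExt.fst_add, hP, hQ]
  simp only [deriv, AddMonoidHom.coe_mk, ZeroHom.coe_mk, map_mul, TrivSqZeroExt.snd_mul, h]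
  simp

/-- Changing the values of a derivation by commutators with `z`. -/
theorem deriv_add_commutator (x y z P : NCPoly) :
    deriv (x + z * X₁ - X₁ * z) (y + z * X₂ - X₂ * z) P = deriv x y P + z * P - P * z := by
  induction P using NCPoly.induction with
  | intCast r => simp [deriv_intCast, Int.cast_comm]
  | X₁ => simp [deriv_X₁]
  | X₂ => simp [deriv_X₂]
  | mul P Q hP hQ =>
    rw [deriv_mul, deriv_mul, hP, hQ]
    noncomm_ring
  | add P Q hP hQ =>
    rw [map_add, map_add, hP, hQ]
    noncomm_ring

/-- The derivation `a ↦ ba`, `b ↦ ab` sends `a + b` to `d` and `ab + ba` to `cd`, so it restricts to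
`cd`-polynomials. -/
theorem cdHom_deriv (P : NCPoly) :
    cdHom (deriv X₂ (X₁ * X₂) P) = deriv (X₂ * X₁) (X₁ * X₂) (cdHom P) := by
  induction P using NCPoly.induction with
  | intCast r => simp [deriv_intCast]
  | X₁ => simp [deriv_X₁, deriv_X₂, add_comm]
  | X₂ =>
    simp [deriv_X₁, deriv_X₂, deriv_mul]
    noncomm_ring
  | mul P Q hP hQ => simp only [deriv_mul, map_mul, map_add, hP, hQ]
  | add P Q hP hQ => simp only [map_add, hP, hQ]

/-! ### Words of lists and insertion of a maximal entry -/

/-- The `ab`-word recording the ascents and descents of a list. -/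
noncomputable def word : List ℕ → NCPoly
  | [] => 1
  | [_] => 1
  | x :: y :: l => (if x > y then X₂ else X₁) * word (y :: l)

theorem sum_word_map_cons (x y : ℕ) (L : List (List ℕ)) (hL : ∀ l ∈ L, l.head? = some y) :
    ((L.map (List.cons x)).map word).sum =
      (if x > y then X₂ else X₁) * (L.map word).sum := by
  induction L with
  | nil => simp
  | cons l L ih =>
    obtain ⟨h₁, h₂⟩ := List.forall_mem_cons.1 hL
    obtain ⟨t, rfl⟩ := List.head?_eq_some_iff.1 h₁
    simp only [List.map_cons, List.sum_cons, ih h₂, word, mul_add]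

/-- The insertions of a large entry into a list, at all places but the first. -/
theorem sum_word_map_cons_permutations'Aux (m : ℕ) (l : List ℕ) : ∀ x : ℕ,
    (∀ z ∈ x :: l, z < m) →
    (((List.permutations'Aux m l).map (List.cons x)).map word).sum =
      word (x :: l) * X₁ + deriv (X₁ * X₂) (X₁ * X₂) (word (x :: l)) := by
  induction l with
  | nil =>
    intro x hx
    have : ¬ x > m := by have := hx x (by simp); omega
    simp [word, deriv_one, this]
  | cons y l ih =>
    intro x hx
    have h₁ : ¬ x > m := by have := hx x (by simp); omega
    have h₂ : m > y := hx y (by simp)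
    have h₃ : deriv (X₁ * X₂) (X₁ * X₂) (if x > y then X₂ else X₁) = X₁ * X₂ := by
      split_ifs
      · exact deriv_X₂ _ _
      · exact deriv_X₁ _ _
    have h₄ := sum_word_map_cons x y ((List.permutations'Aux m l).map (List.cons y)) (by simp)
    rw [ih y fun z hz => hx z (by simp_all)] at h₄
    rw [List.permutations'Aux, List.map_cons, List.map_cons, List.sum_cons, h₄]
    simp only [word, h₁, h₂, if_true, if_false, deriv_mul, h₃]
    noncomm_ring

/-- The maximum `m` adds an initial `b` when placed first and a final `a` when placed last; in
between, it replaces the letter of its gap by `ab`. -/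
theorem sum_word_permutations'Aux (m : ℕ) (l : List ℕ) (hl : l ≠ []) (hm : ∀ z ∈ l, z < m) :
    ((List.permutations'Aux m l).map word).sum =
      X₂ * word l + word l * X₁ + deriv (X₁ * X₂) (X₁ * X₂) (word l) := by
  cases l with
  | nil => exact absurd rfl hl
  | cons x l =>
    have h : m > x := hm x (by simp)
    rw [List.permutations'Aux, List.map_cons, List.sum_cons,
      sum_word_map_cons_permutations'Aux m l x hm, word, if_pos h, add_assoc]

/-- The list `[n, n - 1, …, 1]`. -/
def downList : ℕ → List ℕ
  | 0 => []
  | n + 1 => (n + 1) :: downList n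

theorem mem_downList {n x : ℕ} : x ∈ downList n ↔ 1 ≤ x ∧ x ≤ n := by
  induction n with
  | zero => simp [downList]; omega
  | succ n ih => rw [downList, List.mem_cons, ih]; omega

theorem length_downList (n : ℕ) : (downList n).length = n := by
  induction n with
  | zero => rfl
  | succ n ih => simp [downList, ih]

theorem nodup_downList (n : ℕ) : (downList n).Nodup := by
  induction n with
  | zero => simp [downList]
  | succ n ih => simp [downList, ih, mem_downList]

theorem nodup_permutations' (l : List ℕ) (h : l.Nodup) : l.permutations'.Nodup :=
  (l.permutations_perm_permutations').nodup_iff.1 (List.nodup_permutations l h)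

theorem sum_word_permutations'_downList_succ (n : ℕ) (hn : 1 ≤ n) :
    ((downList (n + 1)).permutations'.map word).sum =
      X₂ * ((downList n).permutations'.map word).sum +
      ((downList n).permutations'.map word).sum * X₁ +
      deriv (X₁ * X₂) (X₁ * X₂) ((downList n).permutations'.map word).sum := by
  have h : ∀ l ∈ (downList n).permutations', l ≠ [] ∧ ∀ z ∈ l, z < n + 1 := by
    intro l hl
    rw [List.mem_permutations'] at hl
    refine ⟨?_, fun z hz => ?_⟩
    · rintro rfl
      have := hl.length_eq
      simp [length_downList] at this
      omega
    · have := mem_downList.1 (hl.subset hz)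
      omega
  rw [downList, List.permutations']
  generalize (downList n).permutations' = L at h
  induction L with
  | nil => simp
  | cons l L ih =>
    obtain ⟨⟨h₁, h₂⟩, h₃⟩ := List.forall_mem_cons.1 h
    rw [List.flatMap_cons, List.map_append, List.sum_append, ih h₃,
      sum_word_permutations'Aux _ l h₁ h₂, List.map_cons, List.sum_cons, map_add]
    noncomm_ring

/-! ### The recursion for the generating function of the descent set -/

theorem descentSet_subset {n : ℕ} (σ : Equiv.Perm (Fin n)) : descentSet σ ⊆ Icc 1 (n - 1) :=
  filter_subset _ _

theorem altDescentSet_subset {n : ℕ} (σ : Equiv.Perm (Fin n)) :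
    altDescentSet σ ⊆ Icc 1 (n - 1) :=
  filter_subset _ _

theorem sum_card_fiber_smul {α : Type*} [Fintype α] (s : Finset ℕ) (D : α → Finset ℕ)
    (hD : ∀ x, D x ⊆ s) (g : Finset ℕ → NCPoly) :
    ∑ S ∈ s.powerset, #{x | D x = S} • g S = ∑ x, g (D x) := by
  rw [← sum_fiberwise_of_maps_to (g := D) (t := s.powerset) (by simpa using hD)]
  refine sum_congr rfl fun S _ => ?_
  rw [sum_congr rfl fun x hx => by rw [(mem_filter.1 hx).2], sum_const]

theorem Psi_eq_sum (n : ℕ) :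
    Psi n = ∑ σ : Equiv.Perm (Fin n), abMonomial n (descentSet σ) :=
  sum_card_fiber_smul _ _ descentSet_subset _

theorem PsiHat_eq_sum (n : ℕ) :
    PsiHat n = ∑ σ : Equiv.Perm (Fin n), abMonomial n (altDescentSet σ) :=
  sum_card_fiber_smul _ _ altDescentSet_subset _

theorem word_map_range' (f : ℕ → ℕ) (s k : ℕ) :
    word ((List.range' s (k + 1)).map f) =
      ((List.range' s k).map fun i => if f i > f (i + 1) then X₂ else X₁).prod := by
  induction k generalizing s with
  | zero => simp [word]
  | succ k ih =>
    have := ih (s + 1)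
    simp only [List.range'_succ, List.map_cons, List.prod_cons, word] at this ⊢
    rw [this]

/-- One-line notation of a permutation as a list. -/
def entries {n : ℕ} (σ : Equiv.Perm (Fin n)) : List ℕ := (List.range' 1 n).map (entry σ)

theorem abMonomial_descentSet {n : ℕ} (σ : Equiv.Perm (Fin n)) :
    abMonomial n (descentSet σ) = word (entries σ) := by
  cases n with
  | zero => simp [abMonomial, entries, word]
  | succ n =>
    rw [entries, word_map_range', abMonomial]
    congr 1
    refine List.map_congr_left fun i hi => ?_
    have : i ∈ descentSet σ ↔ entry σ i > entry σ (i + 1) := by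
      simp [descentSet] at hi ⊢
      omega
    simp [this]

theorem entry_of_mem {n : ℕ} (σ : Equiv.Perm (Fin n)) {i : ℕ} (h : i < n) :
    entry σ (i + 1) = σ ⟨i, h⟩ + 1 := by
  rw [entry, dif_pos (by omega)]
  simp

theorem entry_injOn {n : ℕ} (σ : Equiv.Perm (Fin n)) {i j : ℕ} (hi : 1 ≤ i ∧ i ≤ n)
    (hj : 1 ≤ j ∧ j ≤ n) (h : entry σ i = entry σ j) : i = j := by
  rw [entry, entry, dif_pos hi, dif_pos hj] at h
  have := σ.injective (Fin.ext (Nat.succ_injective h))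
  simp at this
  omega

theorem entries_injective (n : ℕ) : Function.Injective (entries (n := n)) := by
  intro σ τ h
  ext i
  have h' := (List.map_inj_left.1 h) (i + 1) (by simp; omega)
  rw [entry_of_mem σ i.2, entry_of_mem τ i.2] at h'
  exact Nat.succ_injective h'

theorem entries_perm {n : ℕ} (σ : Equiv.Perm (Fin n)) : (entries σ).Perm (downList n) := by
  have hnd : (entries σ).Nodup := by
    refine List.Nodup.map_on (fun i hi j hj h => ?_) List.nodup_range'
    simp at hi hj
    exact entry_injOn σ (by omega) (by omega) h
  refine (List.subperm_of_subset hnd fun x hx => ?_).perm_of_length_le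
    (by simp [entries, length_downList])
  obtain ⟨i, hi, rfl⟩ := List.mem_map.1 hx
  simp at hi
  rw [mem_downList, entry, dif_pos (by omega)]
  omega

theorem Psi_eq_sum_permutations' (n : ℕ) :
    Psi n = ((downList n).permutations'.map word).sum := by
  have hnd := nodup_permutations' _ (nodup_downList n)
  have h : univ.image (entries (n := n)) = (downList n).permutations'.toFinset := by
    refine eq_of_subset_of_card_le (fun l hl => ?_) ?_
    · obtain ⟨σ, -, rfl⟩ := mem_image.1 hl
      rw [List.mem_toFinset, List.mem_permutations']
      exact entries_perm σ
    · rw [card_image_of_injective _ (entries_injective n), card_univ, Fintype.card_perm,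
        Fintype.card_fin, List.toFinset_card_of_nodup hnd,
        ← (List.permutations_perm_permutations' _).length_eq, List.length_permutations,
        length_downList]
  rw [Psi_eq_sum, ← List.sum_toFinset _ hnd, ← h,
    sum_image (entries_injective n).injOn]
  exact sum_congr rfl fun σ _ => abMonomial_descentSet σ

theorem Psi_one : Psi 1 = 1 := by
  simp [Psi_eq_sum_permutations', downList, word]

theorem Psi_succ (n : ℕ) (hn : 1 ≤ n) :
    Psi (n + 1) = X₂ * Psi n + Psi n * X₁ + deriv (X₁ * X₂) (X₁ * X₂) (Psi n) := by
  simp only [Psi_eq_sum_permutations']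
  exact sum_word_permutations'_downList_succ n hn

/-- The recursion obtained by inserting a minimal entry. -/
theorem Psi_succ' (n : ℕ) (hn : 1 ≤ n) :
    Psi (n + 1) = X₁ * Psi n + Psi n * X₂ + deriv (X₂ * X₁) (X₂ * X₁) (Psi n) := by
  have h := deriv_add_commutator (X₁ * X₂) (X₁ * X₂) (X₂ - X₁) (Psi n)
  have h₁ : X₁ * X₂ + (X₂ - X₁) * X₁ - X₁ * (X₂ - X₁) = X₂ * X₁ := by noncomm_ring
  have h₂ : X₁ * X₂ + (X₂ - X₁) * X₂ - X₂ * (X₂ - X₁) = X₂ * X₁ := by noncomm_ring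
  rw [h₁, h₂] at h
  rw [h, Psi_succ n hn]
  noncomm_ring

theorem Psi_succ_eq_mul_add (n : ℕ) (hn : 1 ≤ n) :
    Psi (n + 1) = Psi n * (X₁ + X₂) + deriv (X₂ * X₁) (X₁ * X₂) (Psi n) := by
  have h := deriv_add_commutator (X₁ * X₂) (X₁ * X₂) X₂ (Psi n)
  have h₁ : X₁ * X₂ + X₂ * X₁ - X₁ * X₂ = X₂ * X₁ := by noncomm_ring
  have h₂ : X₁ * X₂ + X₂ * X₂ - X₂ * X₂ = X₁ * X₂ := by noncomm_ring
  rw [h₁, h₂] at h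
  rw [h, Psi_succ n hn]
  noncomm_ring

/-- The `cd`-index of the Boolean algebra exists. -/
theorem exists_cdHom_eq_Psi (n : ℕ) (hn : 1 ≤ n) : ∃ Φ, cdHom Φ = Psi n := by
  induction n, hn using Nat.le_induction with
  | base => exact ⟨1, by rw [map_one, Psi_one]⟩
  | succ n hn ih =>
    obtain ⟨Φ, hΦ⟩ := ih
    refine ⟨Φ * X₁ + deriv X₂ (X₁ * X₂) Φ, ?_⟩
    rw [map_add, map_mul, cdHom_deriv, hΦ, Psi_succ_eq_mul_add n hn, evalHom_X₁]

/-! ### Functionals determined by the recursion -/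

/-- The span of the products `Ψ_i ba Ψ_j` with `1 ≤ i, j ≤ n`. -/
def psiProducts (n : ℕ) : AddSubgroup NCPoly :=
  AddSubgroup.closure {P | ∃ i j, 1 ≤ i ∧ i ≤ n ∧ 1 ≤ j ∧ j ≤ n ∧ P = Psi i * (X₂ * X₁) * Psi j}

theorem mem_psiProducts {n i j : ℕ} (hi : 1 ≤ i ∧ i ≤ n) (hj : 1 ≤ j ∧ j ≤ n) :
    Psi i * (X₂ * X₁) * Psi j ∈ psiProducts n :=
  AddSubgroup.subset_closure ⟨i, j, hi.1, hi.2, hj.1, hj.2, rfl⟩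

/-- The operator `T(P) = aP + Pb + D(P)`, with `D(a) = D(b) = ba`, obeys a Leibniz rule at `ba`:
`T(P ba Q) = T(P) ba Q + P ba T(Q)`, since `D(ba) = b·ba + ba·a`. -/
theorem psiProducts_succ {n : ℕ} {P : NCPoly} (hP : P ∈ psiProducts n) :
    X₁ * P + P * X₂ + deriv (X₂ * X₁) (X₂ * X₁) P ∈ psiProducts (n + 1) := by
  induction hP using AddSubgroup.closure_induction with
  | mem P hP =>
    obtain ⟨i, j, hi, hi', hj, hj', rfl⟩ := hP
    have h := add_mem (mem_psiProducts (n := n + 1) (i := i + 1) (j := j) (by omega) (by omega))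
      (mem_psiProducts (n := n + 1) (i := i) (j := j + 1) (by omega) (by omega))
    rw [Psi_succ' i hi, Psi_succ' j hj] at h
    convert h using 1
    simp only [deriv_mul, deriv_X₁, deriv_X₂]
    noncomm_ring
  | zero => simp
  | add P Q _ _ hP hQ =>
    convert add_mem hP hQ using 1
    simp only [map_add]
    noncomm_ring
  | neg P _ hP =>
    convert neg_mem hP using 1
    simp only [map_neg]
    noncomm_ring

theorem deriv_Psi_mem_psiProducts (n : ℕ) (hn : 1 ≤ n) :
    deriv (X₂ * X₁) (X₂ * X₁) (Psi n) ∈ psiProducts n := by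
  induction n, hn using Nat.le_induction with
  | base => simp [Psi_one, deriv_one]
  | succ n hn ih =>
    have h := psiProducts_succ ih
    have h₁ := mem_psiProducts (n := n + 1) (i := 1) (j := n) (by omega) (by omega)
    have h₂ := mem_psiProducts (n := n + 1) (i := n) (j := 1) (by omega) (by omega)
    -- With `T` the recursion operator, `D(T(P)) = ba P + P ba + T(D(P))`; the factor `Ψ_1 = 1`
    -- makes the first two terms products.
    convert add_mem (add_mem h₁ h₂) h using 1
    rw [Psi_succ' n hn, Psi_one]
    simp only [map_add, deriv_mul, deriv_X₁, deriv_X₂]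
    noncomm_ring

/-- Additive functionals that are multiplicative at `ba` are determined on all `Ψ_n`. -/
theorem eq_on_Psi {K : Type*} [CommRing K] (L₁ L₂ : NCPoly →+ K)
    (one₁ : L₁ 1 = 1) (one₂ : L₂ 1 = 1)
    (add₁ : ∀ P, L₁ (X₁ * P + P * X₂) = L₁ P) (add₂ : ∀ P, L₂ (X₁ * P + P * X₂) = L₂ P)
    (mul₁ : ∀ P Q, L₁ (P * (X₂ * X₁) * Q) = L₁ P * L₁ Q)
    (mul₂ : ∀ P Q, L₂ (P * (X₂ * X₁) * Q) = L₂ P * L₂ Q) (n : ℕ) (hn : 1 ≤ n) :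
    L₁ (Psi n) = L₂ (Psi n) := by
  induction n using Nat.strong_induction_on with
  | _ n ih =>
    obtain rfl | hn' := hn.eq_or_lt
    · rw [Psi_one, one₁, one₂]
    obtain ⟨m, rfl⟩ : ∃ m, n = m + 1 := ⟨n - 1, by omega⟩
    have h : ∀ P ∈ psiProducts m, L₁ P = L₂ P := by
      intro P hP
      induction hP using AddSubgroup.closure_induction with
      | mem P hP =>
        obtain ⟨i, j, hi, hi', hj, hj', rfl⟩ := hP
        rw [mul₁, mul₂, ih i (by omega) hi, ih j (by omega) hj]
      | zero => simp
      | add P Q _ _ hP hQ => rw [map_add, map_add, hP, hQ]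
      | neg P _ hP => rw [map_neg, map_neg, hP]
    rw [Psi_succ' m (by omega), map_add, map_add L₂, add₁, add₂, ih m (by omega) (by omega),
      h _ (deriv_Psi_mem_psiProducts m (by omega))]

/-! ### Counting permutations without double descents and final descent -/

/-- Reading the letter `a`. -/
def reducedA : AddMonoid.End (ℤ × ℤ) where
  toFun v := (v.1, v.1)
  map_zero' := rfl
  map_add' _ _ := rfl

/-- Reading the letter `b`. -/
def reducedB : AddMonoid.End (ℤ × ℤ) where
  toFun v := (v.2, 0)
  map_zero' := rfl
  map_add' _ _ := rfl

theorem reducedA_apply (v : ℤ × ℤ) : reducedA v = (v.1, v.1) := rfl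

theorem reducedB_apply (v : ℤ × ℤ) : reducedB v = (v.2, 0) := rfl

/-- The sum of the coefficients of the words without factor `bb` that do not end with `b`. -/
noncomputable def reducedSum : NCPoly →+ ℤ where
  toFun P := (evalHom reducedA reducedB P (1, 0)).1
  map_zero' := by simp
  map_add' P Q := by simp [end_add_apply]

theorem reducedSum_apply (P : NCPoly) :
    reducedSum P = (evalHom reducedA reducedB P (1, 0)).1 := rfl

theorem reducedSum_one : reducedSum 1 = 1 := by simp [reducedSum_apply]

theorem reducedSum_add (P : NCPoly) : reducedSum (X₁ * P + P * X₂) = reducedSum P := by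
  simp only [reducedSum_apply, map_add, map_mul, evalHom_X₁, evalHom_X₂, end_mul_apply,
    reducedA_apply, reducedB_apply]
  rw [show ((0, 0) : ℤ × ℤ) = 0 from rfl, map_zero, Prod.fst_zero, add_zero]

theorem reducedSum_mul (P Q : NCPoly) :
    reducedSum (P * (X₂ * X₁) * Q) = reducedSum P * reducedSum Q := by
  simp only [reducedSum_apply, map_mul, evalHom_X₁, evalHom_X₂, end_mul_apply, reducedA_apply,
    reducedB_apply]
  generalize (evalHom reducedA reducedB Q (1, 0)).1 = q
  -- Once `ba` is read, the state is a multiple of the initial one, so the remaining factor starts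
  -- afresh.
  rw [show ((q, 0) : ℤ × ℤ) = q • (1, 0) by simp, map_zsmul]
  simp [mul_comm]

/-- The set `S` has no two consecutive elements in `[s, e)` and does not contain `e - 1`. -/
def FallsIsolated (S : Finset ℕ) (s e : ℕ) : Prop :=
  ∀ i, s ≤ i → i < e → i ∈ S → i + 1 ∉ S ∧ i + 1 ≠ e

theorem fallsIsolated_succ (S : Finset ℕ) (s k : ℕ) :
    FallsIsolated S s (s + (k + 1)) ↔
      FallsIsolated S (s + 1) (s + 1 + k) ∧ (s ∈ S → s + 1 ∉ S ∧ k ≠ 0) := by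
  constructor
  · intro h
    refine ⟨fun i h₁ h₂ h₃ => ?_, fun hs => ?_⟩
    · have := h i (by omega) (by omega) h₃
      exact ⟨this.1, by omega⟩
    · have := h s le_rfl (by omega) hs
      exact ⟨this.1, by omega⟩
  · rintro ⟨h, h'⟩ i h₁ h₂ h₃
    obtain rfl | h₄ := h₁.eq_or_lt
    · exact ⟨(h' h₃).1, by have := (h' h₃).2; omega⟩
    · have := h i (by omega) (by omega) h₃
      exact ⟨this.1, by omega⟩

-- Words are read from the right. The state tells whether the suffix is admissible, and whether a
-- `b` may precede it; for the empty suffix it may not, whence `k ≠ 0`.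
open Classical in
theorem reduced_word_apply (S : Finset ℕ) (k : ℕ) : ∀ s : ℕ,
    evalHom reducedA reducedB ((List.range' s k).map fun i => if i ∈ S then X₂ else X₁).prod
      (1, 0) =
    (if FallsIsolated S s (s + k) then 1 else 0,
      if k ≠ 0 ∧ s ∉ S ∧ FallsIsolated S s (s + k) then 1 else 0) := by
  induction k with
  | zero =>
    intro s
    have : FallsIsolated S s (s + 0) := fun i _ _ => by omega
    rw [if_pos this]
    simp
  | succ k ih =>
    intro s
    rw [List.range'_succ, List.map_cons, List.prod_cons, map_mul, end_mul_apply, ih (s + 1)]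
    simp only [fallsIsolated_succ]
    by_cases hs : s ∈ S
    · simp only [hs, if_true, evalHom_X₂, reducedB_apply, true_imp_iff, not_true, false_and,
        and_false, if_false]
      congr 2
      simp only [eq_iff_iff]
      tauto
    · simp [hs, evalHom_X₁, reducedA_apply]

theorem reducedSum_Psi (n : ℕ) : reducedSum (Psi n) = #(reducedPerms n) := by
  rw [Psi_eq_sum, map_sum, reducedPerms, card_filter]
  push_cast
  refine sum_congr rfl fun σ _ => ?_
  classical
  rw [reducedSum_apply, abMonomial, reduced_word_apply]
  refine if_congr ?_ rfl rfl
  have hD := descentSet_subset σ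
  constructor
  · intro h
    refine ⟨fun i hi => ?_, fun h' => ?_⟩
    · have := mem_Icc.1 (hD hi)
      exact (h i (by omega) (by omega) hi).1
    · have := mem_Icc.1 (hD h')
      exact (h (n - 1) (by omega) (by omega) h').2 (by omega)
  · rintro ⟨h, h'⟩ i h₁ h₂ h₃
    refine ⟨h i h₃, fun h₄ => h' ?_⟩
    rwa [show n - 1 = i by omega]

/-! ### The evaluation at `c = 1`, `d = 2` -/

/-- At `a = α`, `b = 1 - α` one has `c = 1`, `ba = 1` and `d = 2`, as `eq_on_Psi` and the value
`Φ(1, 2)` require. -/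
theorem exists_mul_one_sub_eq_one : ∃ α : ℂ, α * (1 - α) = 1 := by
  obtain ⟨z, hz⟩ := IsAlgClosed.exists_pow_nat_eq (-3 : ℂ) two_pos
  exact ⟨(1 + z) / 2, by linear_combination -hz / 4⟩

theorem evalHom_one_two (n : ℕ) (hn : 1 ≤ n) (Φ : NCPoly) (hΦ : cdHom Φ = Psi n) :
    evalHom (1 : ℤ) 2 Φ = #(reducedPerms n) := by
  obtain ⟨α, hα⟩ := exists_mul_one_sub_eq_one
  have h := eq_on_Psi (evalHom α (1 - α)).toAddMonoidHom
    ((Int.castAddHom ℂ).comp reducedSum) (by simp) (by simp [reducedSum_one])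
    (fun P => by simp; ring)
    (fun P => by simp only [AddMonoidHom.comp_apply, reducedSum_add])
    (fun P Q => by
      simp only [RingHom.toAddMonoidHom_eq_coe, AddMonoidHom.coe_coe, map_mul, evalHom_X₁, evalHom_X₂]
      linear_combination evalHom α (1 - α) P * evalHom α (1 - α) Q * hα)
    (fun P Q => by simp [reducedSum_mul]) n hn
  rw [AddMonoidHom.comp_apply, reducedSum_Psi n, ← hΦ] at h
  have h' : evalHom α (1 - α) (cdHom Φ) = evalHom (1 : ℂ) 2 Φ := by
    rw [map_evalHom]
    congr 2
    · simp
    · simp only [map_add, map_mul, evalHom_X₁, evalHom_X₂]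
      linear_combination 2 * hα
  have h'' := map_evalHom (Int.castRingHom ℂ) 1 2 Φ
  simp only [map_one, map_ofNat, eq_intCast] at h''
  have : ((evalHom (1 : ℤ) 2 Φ : ℤ) : ℂ) = ((#(reducedPerms n) : ℤ) : ℂ) := by
    rw [h'', ← h']
    exact h
  exact_mod_cast this

/-! ### Alternating descents -/

/-- Reading the letter `a`, with the roles of the letters alternating. -/
noncomputable def alternateA : AddMonoid.End (NCPoly × NCPoly) where
  toFun v := (X₁ * v.2, X₂ * v.1)
  map_zero' := by simp
  map_add' u v := by simp [mul_add]

/-- Reading the letter `b`, with the roles of the letters alternating. -/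
noncomputable def alternateB : AddMonoid.End (NCPoly × NCPoly) where
  toFun v := (X₂ * v.2, X₁ * v.1)
  map_zero' := by simp
  map_add' u v := by simp [mul_add]

theorem alternateA_apply (v : NCPoly × NCPoly) : alternateA v = (X₁ * v.2, X₂ * v.1) := rfl

theorem alternateB_apply (v : NCPoly × NCPoly) : alternateB v = (X₂ * v.2, X₁ * v.1) := rfl

/-- Diagonal pairs are preserved: `AB` sends `(Q, Q)` to `(a²Q, b²Q)` and `BA` sends it to `(b²Q,
a²Q)`, with sum `a² + b² = c² - d` on both coordinates. -/
theorem alternate_cdHom (P : NCPoly) : ∀ Q : NCPoly,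
    evalHom alternateA alternateB (cdHom P) (Q, Q) =
      (cdHom (evalHom X₁ (X₁ * X₁ - X₂) P) * Q, cdHom (evalHom X₁ (X₁ * X₁ - X₂) P) * Q) := by
  induction P using NCPoly.induction with
  | intCast r => intro Q; simp [AddMonoid.End.intCast_apply]
  | X₁ => intro Q; simp [end_add_apply, alternateA_apply, alternateB_apply, add_mul, add_comm]
  | X₂ =>
    intro Q
    simp only [evalHom_X₁, evalHom_X₂, map_add, map_sub, map_mul, end_add_apply, end_mul_apply,
      alternateA_apply, alternateB_apply, Prod.mk_add_mk, Prod.mk.injEq]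
    exact ⟨by noncomm_ring, by noncomm_ring⟩
  | mul P R hP hR => intro Q; simp only [map_mul, end_mul_apply, hR, hP, mul_assoc]
  | add P R hP hR =>
    intro Q
    simp only [map_add, end_add_apply, hP, hR, Prod.mk_add_mk, add_mul]

/-- The first coordinate treats the leading letter as standing at an odd position, the second as at
an even one; for even `s` the two are therefore interchanged. -/
theorem alternate_word (S T : Finset ℕ) (k : ℕ) : ∀ s : ℕ,
    (∀ i, s ≤ i → i < s + k → (i ∈ T ↔ (Odd i ↔ i ∈ S))) →
    evalHom alternateA alternateB
      ((List.range' s k).map fun i => if i ∈ S then X₂ else X₁).prod (1, 1) =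
    if Odd s then
      (((List.range' s k).map fun i => if i ∈ T then X₂ else X₁).prod,
        ((List.range' s k).map fun i => if i ∈ T then X₁ else X₂).prod)
    else
      (((List.range' s k).map fun i => if i ∈ T then X₁ else X₂).prod,
        ((List.range' s k).map fun i => if i ∈ T then X₂ else X₁).prod) := by
  induction k with
  | zero => intro s _; simp
  | succ k ih =>
    intro s h
    have hs := h s le_rfl (by omega)
    rw [List.range'_succ, List.map_cons, List.prod_cons, map_mul, end_mul_apply,
      ih (s + 1) fun i h₁ h₂ => h i (by omega) (by omega)]
    by_cases h₁ : Odd s <;> by_cases h₂ : s ∈ S <;>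
      simp [h₁, h₂, hs, Nat.odd_add_one, alternateA_apply, alternateB_apply]

theorem mem_altDescentSet {n : ℕ} (σ : Equiv.Perm (Fin n)) {i : ℕ} (h₁ : 1 ≤ i)
    (h₂ : i < 1 + (n - 1)) : i ∈ altDescentSet σ ↔ (Odd i ↔ i ∈ descentSet σ) := by
  have h : entry σ i ≠ entry σ (i + 1) := fun h => by
    have := entry_injOn σ (by omega) (by omega) h
    omega
  have h₃ : i ∈ Icc 1 (n - 1) := mem_Icc.2 (by omega)
  simp only [altDescentSet, descentSet, mem_filter, h₃, true_and, ← Nat.not_odd_iff_even]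
  by_cases h₄ : Odd i <;> grind

/-- The exchange of the two letters at all even positions. -/
noncomputable def alternate : NCPoly →+ NCPoly where
  toFun P := (evalHom alternateA alternateB P (1, 1)).1
  map_zero' := by simp
  map_add' P Q := by simp [end_add_apply]

theorem alternate_apply (P : NCPoly) :
    alternate P = (evalHom alternateA alternateB P (1, 1)).1 := rfl

theorem alternate_Psi (n : ℕ) : alternate (Psi n) = PsiHat n := by
  have h : ∀ σ : Equiv.Perm (Fin n),
      alternate (abMonomial n (descentSet σ)) = abMonomial n (altDescentSet σ) := by
    intro σ
    rw [alternate_apply, abMonomial, alternate_word (descentSet σ) (altDescentSet σ) (n - 1) 1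
      fun i h₁ h₂ => mem_altDescentSet σ h₁ h₂, if_pos odd_one, abMonomial]
  rw [Psi_eq_sum, PsiHat_eq_sum, map_sum]
  exact sum_congr rfl fun σ _ => h σ

theorem cdHom_eq_PsiHat (n : ℕ) (Φ : NCPoly) (hΦ : cdHom Φ = Psi n) :
    cdHom (evalHom X₁ (X₁ * X₁ - X₂) Φ) = PsiHat n := by
  rw [← alternate_Psi, ← hΦ, alternate_apply, alternate_cdHom, mul_one]

theorem isCdForm_iff {P Q : NCPoly} : IsCdForm P Q ↔ cdHom P = Q := Iff.rfl

end CdIndex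

theorem theorem7p6 (n : ℕ) (hn : 1 ≤ n) :
    (∃! Φ : CdIndex.NCPoly, CdIndex.IsCdForm Φ (CdIndex.Psi n)) ∧
    (∃! Φhat : CdIndex.NCPoly, CdIndex.IsCdForm Φhat (CdIndex.PsiHat n)) ∧
    ∀ Φ Φhat : CdIndex.NCPoly,
      CdIndex.IsCdForm Φ (CdIndex.Psi n) → CdIndex.IsCdForm Φhat (CdIndex.PsiHat n) →
        CdIndex.coeffSum (CdIndex.evalAt Φhat CdIndex.X₁ (-CdIndex.X₂)) =
            ((CdIndex.reducedPerms n).card : ℤ) ∧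
          CdIndex.evalAt Φ (1 : ℤ) (2 : ℤ) = ((CdIndex.reducedPerms n).card : ℤ) := by
  simp only [CdIndex.isCdForm_iff, CdIndex.coeffSum_eq_evalHom, CdIndex.evalAt_eq_evalHom]
  obtain ⟨Φ, hΦ⟩ := CdIndex.exists_cdHom_eq_Psi n hn
  have hΦhat := CdIndex.cdHom_eq_PsiHat n Φ hΦ
  refine ⟨⟨Φ, hΦ, fun P hP => CdIndex.cdHom_injective (hP.trans hΦ.symm)⟩,
    ⟨_, hΦhat, fun P hP => CdIndex.cdHom_injective (hP.trans hΦhat.symm)⟩, fun P Q hP hQ => ?_⟩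
  rw [CdIndex.cdHom_injective (hP.trans hΦ.symm), CdIndex.cdHom_injective (hQ.trans hΦhat.symm),
    CdIndex.map_evalHom, CdIndex.map_evalHom, ← CdIndex.evalHom_one_two n hn Φ hΦ]
  simp only [CdIndex.evalHom_X₁, CdIndex.evalHom_X₂, map_neg, map_sub, map_mul, and_true]
  -- Substituting `c = 1`, `d = -1` in `c² - d` gives `2`.
  norm_num
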